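/- Let $T$ be a signed tree, that is, a finite tree whose vertex set $V = V^- \sqcup V^+$, with $\nu = |V| \ge 1$ elements, is partitioned into negative and positive vertices. View $T$ as a one-dimensional space consisting of its vertices and its open edges. An open subtree of $T$ is a connected component of $T \setminus U$ for some $U \subseteq V$; its boundary $\partial Z$ is the set of vertices that are not in $Z$ but are endpoints of an edge in $Z$. A signed tube is a pair $W = (W^-, W^+)$ of open subtrees with $\partial W^- \subseteq V^- \cap W^+$ and $\partial W^+ \subseteq V^+ \cap W^-$. It is irrelevant if it is $(Z,T)$ with $Z$ a component of $T \setminus V^-$ or $(T,Z)$ with $Z$ a component of $T \setminus V^+$, and relevant otherwise. Two signed tubes $W_1, W_2$ are compatible if at least one of the following four conditions holds: $W_1^- \subseteq W_2^-$ and $W_1^+ \supseteq W_2^+$; $W_1^- \supseteq W_2^-$ and $W_1^+ \subseteq W_2^+$; $W_1^- \cap W_2^- = \emptyset$ and $W_1^+ \cup W_2^+ = T$; $W_1^- \cup W_2^- = T$ and $W_1^+ \cap W_2^+ = \emptyset$. The signed nested complex $\mathcal N(T)$ is the simplicial complex of all sets of pairwise compatible relevant signed tubes. For every signed tree $T$,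 the signed nested complex $\mathcal N(T)$ is a simplicial sphere of dimension $\nu - 2$: its geometric realization is homeomorphic to the unit sphere $\mathbb S^{\nu-2}$ of $\mathbb R^{\nu-1}$ (both are empty if $\nu = 1$). Moreover, $\mathcal N(T)$ is realized by a complete simplicial fan. For a signed tube $W$ let $B_W = (V^- \cap W^-) \cup (V^+ \setminus W^+)$, and let $\rho_W = \mathbb 1_{B_W} - \frac{|B_W|}{\nu} \mathbb 1$ be the orthogonal projection of the characteristic vector of $B_W$ onto the hyperplane $H_0 = \{x \in \mathbb R^V : \sum_v x_v = 0\}$. For every $N \in \mathcal N(T)$ the vectors $\rho_W$, $W \in N$, are linearly independent; the cones $C(N)$ spanned by $\{\rho_W : W \in N\}$ satisfy $C(N) \cap C(N') = C(N \cap N')$ for all $N, N' \in \mathcal N(T)$; and the union of all the cones $C(N)$ is $H_0$. -/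

import Mathlib

/-- A signed tree on the vertex set `V`: a tree together with a partition of `V` into a set of
negative vertices and its complement, the set of positive vertices. -/
structure SignedTree (V : Type*) where
  /-- the underlying graph -/
  graph : SimpleGraph V
  isTree : graph.IsTree
  /-- the set of negative vertices -/
  negVerts : Set V

namespace SignedTree

/-- The set of positive vertices. -/
def posVerts {V : Type*} (T : SignedTree V) : Set V := T.negVertsᶜ

/-- The tree regarded as a one-dimensional cell complex: its cells are its vertices and its
open edges. Subspaces of the tree that are unions of cells are sets of cells. -/
abbrev Cell {V : Type*} (T : SignedTree V) : Type _ := V ⊕ T.graph.edgeSet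

/-- The incidence graph: a vertex is joined to each open edge that it bounds. The connected
components of the tree minus some vertices are the connected components of the subgraph that is
induced on the remaining cells. -/
def cellGraph {V : Type*} (T : SignedTree V) : SimpleGraph T.Cell :=
  SimpleGraph.fromRel fun a b =>
    ∃ (v : V) (e : T.graph.edgeSet), v ∈ (e : Sym2 V) ∧ a = Sum.inl v ∧ b = Sum.inr e

/-- `Z` is a connected component of the complement `T ∖ U` of the set of vertices `U`. -/
def IsComponentOfCompl {V : Type*} (T : SignedTree V) (U : Set V) (Z : Set T.Cell) : Prop :=
  ∃ C : (T.cellGraph.induce (Sum.inl '' U : Set T.Cell)ᶜ).ConnectedComponent,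
    Z = Subtype.val '' C.supp

/-- An open subtree is a connected component of the complement of a set of vertices. -/
def IsOpenSubtree {V : Type*} (T : SignedTree V) (Z : Set T.Cell) : Prop :=
  ∃ U : Set V, T.IsComponentOfCompl U Z

/-- The vertices contained in a set of cells. -/
def verts {V : Type*} (T : SignedTree V) (Z : Set T.Cell) : Set V := {v | Sum.inl v ∈ Z}

/-- The boundary of an open subtree: its excluded leaves. -/
def boundary {V : Type*} (T : SignedTree V) (Z : Set T.Cell) : Set V :=
  {v | v ∉ T.verts Z ∧ ∃ e : T.graph.edgeSet, Sum.inr e ∈ Z ∧ v ∈ (e : Sym2 V)}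

/-- A signed tube: a pair of open subtrees `(W⁻, W⁺)` with `∂W⁻ ⊆ V⁻ ∩ W⁺` and
`∂W⁺ ⊆ V⁺ ∩ W⁻`. -/
@[ext]
structure SignedTube {V : Type*} (T : SignedTree V) where
  /-- the negative part `W⁻` -/
  neg : Set T.Cell
  /-- the positive part `W⁺` -/
  pos : Set T.Cell
  neg_isOpenSubtree : T.IsOpenSubtree neg
  pos_isOpenSubtree : T.IsOpenSubtree pos
  boundary_neg : T.boundary neg ⊆ T.negVerts ∩ T.verts pos
  boundary_pos : T.boundary pos ⊆ T.posVerts ∩ T.verts neg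

namespace SignedTube

/-- A signed tube is irrelevant if it is `(Z, T)` with `Z` a connected component of `T ∖ V⁻`, or
`(T, Z)` with `Z` a connected component of `T ∖ V⁺`. -/
def Irrelevant {V : Type*} {T : SignedTree V} (W : T.SignedTube) : Prop :=
  (T.IsComponentOfCompl T.negVerts W.neg ∧ W.pos = Set.univ) ∨
  (W.neg = Set.univ ∧ T.IsComponentOfCompl T.posVerts W.pos)

/-- `W₁` is negative nested in `W₂`. -/
def NegNested {V : Type*} {T : SignedTree V} (W₁ W₂ : T.SignedTube) : Prop :=
  W₁.neg ⊆ W₂.neg ∧ W₂.pos ⊆ W₁.pos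

/-- `W₁` is positive nested in `W₂`. -/
def PosNested {V : Type*} {T : SignedTree V} (W₁ W₂ : T.SignedTube) : Prop :=
  W₂.neg ⊆ W₁.neg ∧ W₁.pos ⊆ W₂.pos

/-- `W₁` and `W₂` are negative disjoint. -/
def NegDisjoint {V : Type*} {T : SignedTree V} (W₁ W₂ : T.SignedTube) : Prop :=
  W₁.neg ∩ W₂.neg = ∅ ∧ W₁.pos ∪ W₂.pos = Set.univ

/-- `W₁` and `W₂` are positive disjoint. -/
def PosDisjoint {V : Type*} {T : SignedTree V} (W₁ W₂ : T.SignedTube) : Prop :=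
  W₁.neg ∪ W₂.neg = Set.univ ∧ W₁.pos ∩ W₂.pos = ∅

/-- Signed compatibility: signed nested or signed disjoint. -/
def Compatible {V : Type*} {T : SignedTree V} (W₁ W₂ : T.SignedTube) : Prop :=
  (W₁.NegNested W₂ ∨ W₁.PosNested W₂) ∨ (W₁.NegDisjoint W₂ ∨ W₁.PosDisjoint W₂)

/-- The signed building block `(V⁻ ∩ W⁻) ⊔ (V⁺ ∖ W⁺)` of a signed tube. -/
def block {V : Type*} {T : SignedTree V} (W : T.SignedTube) : Set V :=
  (T.negVerts ∩ T.verts W.neg) ∪ (T.posVerts \ T.verts W.pos)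

/-- The characteristic vector of the signed building block of `W`, projected orthogonally onto
the hyperplane of vectors with coordinate sum zero. -/
noncomputable def ray {V : Type*} [Fintype V] {T : SignedTree V} (W : T.SignedTube) : V → ℝ :=
  fun v => W.block.indicator 1 v - (W.block.ncard : ℝ) / (Fintype.card V : ℝ)

end SignedTube

/-- The relevant signed tubes. -/
abbrev RelevantTube {V : Type*} (T : SignedTree V) : Type _ :=
  {W : T.SignedTube // ¬ W.Irrelevant}

instance instFiniteSignedTube {V : Type*} [Finite V] (T : SignedTree V) :
    Finite T.SignedTube :=
  Finite.of_injective (fun W : T.SignedTube => (W.neg, W.pos)) fun _ _ h =>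
    SignedTube.ext (congrArg Prod.fst h) (congrArg Prod.snd h)

/-- The signed nested complex: its faces are the (nonempty, finite) sets of pairwise compatible
relevant signed tubes. -/
def signedNestedComplex {V : Type*} (T : SignedTree V) :
    AbstractSimplicialComplex T.RelevantTube where
  faces := {N | N.Nonempty ∧ ∀ W₁ ∈ N, ∀ W₂ ∈ N, W₁.1.Compatible W₂.1}
  isRelLowerSet_faces := fun _ hN =>
    ⟨hN.1, fun _ hMN hM => ⟨hM, fun W₁ h₁ W₂ h₂ => hN.2 W₁ (hMN h₁) W₂ (hMN h₂)⟩⟩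
  singleton_mem := fun W => ⟨Finset.singleton_nonempty W, by
    intro W₁ h₁ W₂ h₂
    rw [Finset.mem_singleton] at h₁ h₂
    subst h₁ h₂
    exact Or.inl (Or.inl ⟨subset_rfl, subset_rfl⟩)⟩

end SignedTree

namespace AbstractSimplicialComplex

/-- The geometric realization of a finite abstract simplicial complex, in barycentric
coordinates, with the topology induced from `ℝ^ι`. -/
def realization {ι : Type*} [Finite ι] (K : AbstractSimplicialComplex ι) : Set (ι → ℝ) :=
  {x | ∃ s ∈ K.faces, (∀ i, 0 ≤ x i) ∧ (∀ i, i ∉ s → x i = 0) ∧ ∑ i ∈ s, x i = 1}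

/-- `K` is a simplicial sphere of dimension `n - 1`: its geometric realization is homeomorphic to
the unit sphere of the Euclidean space `ℝⁿ` (which is empty for `n = 0`). -/
def IsSimplicialSphere {ι : Type*} [Finite ι] (K : AbstractSimplicialComplex ι) (n : ℕ) : Prop :=
  Nonempty (K.realization ≃ₜ Metric.sphere (0 : EuclideanSpace ℝ (Fin n)) 1)

/-- `K` is realized by a complete simplicial fan in the linear space `H`, with ray `ρ i` for each
vertex `i`: the rays of each face are linearly independent, so that a face spans a simplicial
cone whose faces are the cones of its subsets; the cones of two faces meet along the cone of the
common face; and the cones of all faces, the empty one included, cover exactly `H`. -/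
structure IsRealizedByCompleteFan {ι E : Type*} [AddCommGroup E] [Module ℝ E]
    (K : AbstractSimplicialComplex ι) (H : Submodule ℝ E) (ρ : ι → E) : Prop where
  linearIndependent : ∀ s ∈ K.faces, LinearIndepOn ℝ ρ (s : Set ι)
  cone_inter : ∀ s ∈ K.faces, ∀ t ∈ K.faces,
    (PointedCone.hull ℝ (ρ '' (s : Set ι)) : Set E) ∩ PointedCone.hull ℝ (ρ '' (t : Set ι)) =
      PointedCone.hull ℝ (ρ '' ((s : Set ι) ∩ (t : Set ι)))
  complete : ⋃ s ∈ insert ∅ K.faces, (PointedCone.hull ℝ (ρ '' (s : Set ι)) : Set E) = H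

end AbstractSimplicialComplex

/-- The hyperplane of `ℝ^V` of vectors with coordinate sum zero. -/
def sumZeroHyperplane (V : Type*) [Fintype V] : Submodule ℝ (V → ℝ) where
  carrier := {x | ∑ v, x v = 0}
  add_mem' := by
    intro x y hx hy
    simp only [Set.mem_ofPred_eq] at hx hy ⊢
    simp [Finset.sum_add_distrib, hx, hy]
  zero_mem' := by simp
  smul_mem' := by
    intro c x hx
    simp only [Set.mem_ofPred_eq] at hx ⊢
    simp [← Finset.mul_sum, hx]

/-! Everything follows from one fact: each x in H₀ has exactly one expression as a nonnegative
combination of rays of pairwise compatible relevant tubes. The coefficients are lengths of intervals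
of thresholds.

Existence. For a threshold t let A = {v | t ≤ x v}. Cutting T at the negative vertices outside A and
the positive vertices inside A gives pieces, and a piece with an edge is the central part W⁻ ∩ W⁺ of
a tube "at level A". Every edge lies in the central part of exactly one such tube
(`exists_isAtLevel`, `eq_of_isAtLevel`). The superlevel sets form a chain, so all tubes that occur
for x are compatible (`compatible_of_isAtLevel`). The weight of W is the length of its set of
thresholds. Along an edge uv with x v ≤ x u, the threshold sets of the tubes whose blocks separate u
from v tile (x v, x u]. Hence the weighted sum of rays has the coordinate differences of x, and
equals x (`sum_weight_smul_ray`).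

Uniqueness. If x = ∑ c W ρ_W with compatible support, then c ≤ weight x (`le_weight_sum`). The
difference is again such a combination, now of the vector 0, whose weights vanish; so c = weight x
(`eq_weight_sum`).

Unique conic coordinates yield the fan axioms formally, and radial projection yields the sphere. -/

namespace SimpleGraph

/-! ### Connected sets in acyclic graphs -/

/-- A preconnected set that meets `Y` and cannot be left along `Y` is contained in `Y`. -/
theorem subset_of_induce_preconnected {α : Type*} {G : SimpleGraph α} {Z Y : Set α}
    (hZ : (G.induce Z).Preconnected) (hne : (Z ∩ Y).Nonempty)
    (h : ∀ a ∈ Z, ∀ b ∈ Z, G.Adj a b → a ∈ Y → b ∈ Y) : Z ⊆ Y := by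
  obtain ⟨c, hcZ, hcY⟩ := hne
  intro d hd
  obtain ⟨p⟩ := hZ ⟨c, hcZ⟩ ⟨d, hd⟩
  have key : ∀ (a b : Z), (G.induce Z).Walk a b → (a : α) ∈ Y → (b : α) ∈ Y := by
    intro a b p
    induction p with
    | nil => exact id
    | cons hadj _ ih => exact fun ha => ih (h _ (Subtype.prop _) _ (Subtype.prop _) hadj ha)
  exact key _ _ p hcY

/-- In an acyclic graph, intersections of preconnected sets are preconnected. -/
theorem IsAcyclic.induce_inter_preconnected {α : Type*} {G : SimpleGraph α} (hG : G.IsAcyclic)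
    {Z Y : Set α} (hZ : (G.induce Z).Preconnected) (hY : (G.induce Y).Preconnected) :
    (G.induce (Z ∩ Y)).Preconnected := by
  classical
  rintro ⟨a, haZ, haY⟩ ⟨b, hbZ, hbY⟩
  have path : ∀ S : Set α, (G.induce S).Preconnected → a ∈ S → b ∈ S →
      ∃ p : G.Path a b, ∀ x ∈ p.1.support, x ∈ S := by
    intro S hS ha hb
    obtain ⟨p⟩ := hS ⟨a, ha⟩ ⟨b, hb⟩
    refine ⟨p.toPath.map (Embedding.induce S).toHom
      (Embedding.induce (G := G) S).injective, ?_⟩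
    intro x hx
    replace hx : x ∈ (p.toPath.1.map (Embedding.induce S).toHom).support := hx
    rw [Walk.support_map, List.mem_map] at hx
    obtain ⟨y, -, rfl⟩ := hx
    exact y.2
  obtain ⟨p, hp⟩ := path Z hZ haZ hbZ
  obtain ⟨q, hq⟩ := path Y hY haY hbY
  -- The path inside Z and the path inside Y coincide, because paths in a forest are unique.
  obtain rfl := (hG.subsingleton_path a b).elim p q
  exact ⟨p.1.induce (Z ∩ Y) fun x hx => ⟨hp x hx, hq x hx⟩⟩

/-- A set is a connected component of the subgraph induced on `X` iff it is a nonempty preconnected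
subset of `X` that cannot be left inside `X`. -/
theorem exists_eq_image_supp_induce_iff {α : Type*} {G : SimpleGraph α} {X Z : Set α} :
    (∃ C : (G.induce X).ConnectedComponent, Z = Subtype.val '' C.supp) ↔
      Z.Nonempty ∧ Z ⊆ X ∧ (G.induce Z).Preconnected ∧
        ∀ a ∈ Z, ∀ b ∈ X, G.Adj a b → b ∈ Z := by
  constructor
  · rintro ⟨C, rfl⟩
    have hcl : ∀ a ∈ C.supp, ∀ b : X, (G.induce X).Adj a b → b ∈ C.supp := by
      intro a ha b hab
      rw [ConnectedComponent.mem_supp_iff] at ha ⊢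
      rw [← ha]
      exact ConnectedComponent.sound hab.symm.reachable
    refine ⟨C.nonempty_supp.image _, by rintro _ ⟨x, -, rfl⟩; exact x.2, ?_, ?_⟩
    · have key : ∀ (a b : X), (p : (G.induce X).Walk a b) → ∀ (ha : a ∈ C.supp) (hb : b ∈ C.supp),
          (G.induce (Subtype.val '' C.supp)).Reachable ⟨a, a, ha, rfl⟩ ⟨b, b, hb, rfl⟩ := by
        intro a b p
        induction p with
        | nil => exact fun _ _ => Reachable.refl _
        | @cons u v w hadj _ ih =>
          intro ha hb
          have hv := hcl _ ha _ hadj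
          refine Reachable.trans (Adj.reachable ?_) (ih hv hb)
          exact hadj
      rintro ⟨_, a, ha, rfl⟩ ⟨_, b, hb, rfl⟩
      have hab : (G.induce X).Reachable a b := by
        rw [ConnectedComponent.mem_supp_iff] at ha hb
        exact ConnectedComponent.exact (ha.trans hb.symm)
      obtain ⟨p⟩ := hab
      exact key a b p ha hb
    · rintro _ ⟨a, ha, rfl⟩ b hb hab
      exact ⟨⟨b, hb⟩, hcl a ha ⟨b, hb⟩ hab, rfl⟩
  · rintro ⟨⟨c, hc⟩, hZX, hZ, hcl⟩
    refine ⟨(G.induce X).connectedComponentMk ⟨c, hZX hc⟩, ?_⟩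
    apply Set.Subset.antisymm
    · refine subset_of_induce_preconnected hZ ⟨c, hc, ⟨c, hZX hc⟩, rfl, rfl⟩ ?_
      rintro _ - b hb hab ⟨a, ha, rfl⟩
      refine ⟨⟨b, hZX hb⟩, ?_, rfl⟩
      rw [ConnectedComponent.mem_supp_iff] at ha ⊢
      rw [← ha]
      exact ConnectedComponent.sound (Adj.reachable (G := G.induce X) hab.symm)
    · rintro _ ⟨a, ha, rfl⟩
      obtain ⟨p⟩ := (ConnectedComponent.exact ha).symm
      have key : ∀ (a b : X), (G.induce X).Walk a b → (a : α) ∈ Z → (b : α) ∈ Z := by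
        intro a b p
        induction p with
        | nil => exact id
        | cons hadj _ ih => exact fun ha => ih (hcl _ ha _ (Subtype.prop _) hadj)
      exact key _ _ p hc

end SimpleGraph

/-! ### The tree as a cell complex -/

namespace SignedTree

variable {V : Type*} {T : SignedTree V}

theorem cellGraph_adj_inl_inr {v : V} {e : T.graph.edgeSet} :
    T.cellGraph.Adj (Sum.inl v) (Sum.inr e) ↔ v ∈ (e : Sym2 V) := by
  simp [cellGraph, SimpleGraph.fromRel_adj]

theorem not_cellGraph_adj_inl_inl {v w : V} : ¬ T.cellGraph.Adj (Sum.inl v) (Sum.inl w) := by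
  simp [cellGraph, SimpleGraph.fromRel_adj]

theorem not_cellGraph_adj_inr_inr {e f : T.graph.edgeSet} :
    ¬ T.cellGraph.Adj (Sum.inr e) (Sum.inr f) := by
  simp [cellGraph, SimpleGraph.fromRel_adj]

/-- Every incidence of a vertex with an edge is a bridge, because the edge itself is a bridge of the
tree. -/
theorem cellGraph_isAcyclic (T : SignedTree V) : T.cellGraph.IsAcyclic := by
  have main : ∀ (v : V) (e : T.graph.edgeSet), v ∈ (e : Sym2 V) →
      ¬ (T.cellGraph.deleteEdges {s(Sum.inl v, Sum.inr e)}).Reachable (Sum.inl v) (Sum.inr e) := by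
    rintro v ⟨e, he⟩ hv
    obtain ⟨w, rfl⟩ := Sym2.mem_iff_exists.1 hv
    have hbr := SimpleGraph.isAcyclic_iff_forall_isBridge.1 T.isTree.2 he
    rw [SimpleGraph.isBridge_iff] at hbr
    set G' := T.graph.deleteEdges {s(v, w)} with hG'
    -- The side of v after deleting the edge vw. A walk from v that avoids the incidence of v with
    -- vw never leaves it, and the cell vw is not in it.
    let Y : Set T.Cell := {c | Sum.elim (fun u => G'.Reachable v u)
      (fun f : T.graph.edgeSet => ∀ u ∈ (f : Sym2 V), G'.Reachable v u) c}
    rintro ⟨p⟩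
    have key : ∀ (a b : T.Cell),
        (T.cellGraph.deleteEdges {s(Sum.inl v, Sum.inr ⟨s(v, w), he⟩)}).Walk a b → a ∈ Y → b ∈ Y := by
      intro a b p
      induction p with
      | nil => exact id
      | @cons a c _ hadj _ ih =>
        intro ha
        apply ih
        rw [SimpleGraph.deleteEdges_adj] at hadj
        obtain ⟨hadj, hne⟩ := hadj
        rcases a with u | ⟨f, hf⟩ <;> rcases c with u' | ⟨g, hg⟩
        · exact absurd hadj not_cellGraph_adj_inl_inl
        · rw [cellGraph_adj_inl_inr] at hadj
          intro z hz
          obtain ⟨y, hy⟩ := Sym2.mem_iff_exists.1 hadj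
          change g = s(u, y) at hy
          subst hy
          change G'.Reachable v u at ha
          by_cases hfe : s(u, y) = s(v, w)
          · rcases Sym2.eq_iff.1 hfe with ⟨rfl, rfl⟩ | ⟨rfl, rfl⟩
            · exact absurd rfl hne
            · exact absurd ha hbr
          · have : G'.Adj u y := by
              rw [hG', SimpleGraph.deleteEdges_adj]
              exact ⟨hg, hfe⟩
            rcases Sym2.mem_iff.1 hz with rfl | rfl
            · exact ha
            · exact ha.trans this.reachable
        · exact ha _ (cellGraph_adj_inl_inr.1 hadj.symm)
        · exact absurd hadj not_cellGraph_adj_inr_inr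
    exact hbr (key _ _ p (SimpleGraph.Reachable.refl _) w (Sym2.mem_mk_right v w))
  rw [SimpleGraph.isAcyclic_iff_forall_adj_isBridge]
  intro a b hab
  rw [SimpleGraph.isBridge_iff]
  rcases a with v | e <;> rcases b with w | f
  · exact absurd hab not_cellGraph_adj_inl_inl
  · exact main v f (cellGraph_adj_inl_inr.1 hab)
  · rw [Sym2.eq_swap]
    exact fun h => main w e (cellGraph_adj_inl_inr.1 hab.symm) h.symm
  · exact absurd hab not_cellGraph_adj_inr_inr

theorem cellGraph_preconnected (T : SignedTree V) : T.cellGraph.Preconnected := by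
  have hv : ∀ v w : V, T.cellGraph.Reachable (Sum.inl v) (Sum.inl w) := by
    intro v w
    obtain ⟨p⟩ := T.isTree.1.preconnected v w
    induction p with
    | nil => exact SimpleGraph.Reachable.refl _
    | @cons a b _ hadj _ ih =>
      let e : T.graph.edgeSet := ⟨s(a, b), hadj⟩
      have h1 : T.cellGraph.Adj (Sum.inl a) (Sum.inr e) :=
        cellGraph_adj_inl_inr.2 (Sym2.mem_mk_left a b)
      have h2 : T.cellGraph.Adj (Sum.inl b) (Sum.inr e) :=
        cellGraph_adj_inl_inr.2 (Sym2.mem_mk_right a b)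
      exact h1.reachable.trans (h2.symm.reachable.trans ih)
  have hc : ∀ c : T.Cell, ∃ v : V, T.cellGraph.Reachable c (Sum.inl v) := by
    rintro (v | e)
    · exact ⟨v, SimpleGraph.Reachable.refl _⟩
    · exact ⟨_, (cellGraph_adj_inl_inr.2 (Sym2.out_fst_mem e.1)).symm.reachable⟩
  intro a b
  obtain ⟨v, hav⟩ := hc a
  obtain ⟨w, hbw⟩ := hc b
  exact hav.trans ((hv v w).trans hbw.symm)

/-- A set of cells that contains the open edges at each of its vertices. -/
def IsOpenCells (T : SignedTree V) (Z : Set T.Cell) : Prop :=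
  ∀ (v : V) (e : T.graph.edgeSet), Sum.inl v ∈ Z → v ∈ (e : Sym2 V) → Sum.inr e ∈ Z

theorem IsOpenCells.inter {Y Z : Set T.Cell} (hY : T.IsOpenCells Y) (hZ : T.IsOpenCells Z) :
    T.IsOpenCells (Y ∩ Z) := fun v e h he => ⟨hY v e h.1 he, hZ v e h.2 he⟩

/-- An open set of cells can be left only from an edge to a boundary vertex. Most inclusions between
parts of tubes are proved this way. -/
theorem subset_of_forall_boundary {Y Z : Set T.Cell}
    (hZ : (T.cellGraph.induce Z).Preconnected) (hY : T.IsOpenCells Y) (hne : (Z ∩ Y).Nonempty)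
    (h : ∀ v ∈ T.boundary Y, Sum.inl v ∉ Z) : Z ⊆ Y := by
  refine SimpleGraph.subset_of_induce_preconnected hZ hne ?_
  rintro (v | e) ha (w | f) hb hab haY
  · exact absurd hab not_cellGraph_adj_inl_inl
  · exact hY v f haY (cellGraph_adj_inl_inr.1 hab)
  · by_contra hw
    exact h w ⟨hw, e, haY, cellGraph_adj_inl_inr.1 hab.symm⟩ hb
  · exact absurd hab not_cellGraph_adj_inr_inr

theorem eq_univ_of_boundary_eq_empty {Y : Set T.Cell} (hY : T.IsOpenCells Y) (hne : Y.Nonempty)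
    (h : T.boundary Y = ∅) : Y = Set.univ := by
  refine Set.univ_subset_iff.1 (subset_of_forall_boundary ?_ hY (by simpa using hne) (by simp [h]))
  intro a b
  have := (T.cellGraph_preconnected a b).map (SimpleGraph.induceUnivIso T.cellGraph).symm.toHom
  exact this

theorem isComponentOfCompl_iff {U : Set V} {Z : Set T.Cell} :
    T.IsComponentOfCompl U Z ↔ Z.Nonempty ∧ (∀ v ∈ U, Sum.inl v ∉ Z) ∧
      (T.cellGraph.induce Z).Preconnected ∧ T.IsOpenCells Z ∧ T.boundary Z ⊆ U := by
  unfold IsComponentOfCompl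
  rw [SimpleGraph.exists_eq_image_supp_induce_iff]
  constructor
  · rintro ⟨h1, h2, h3, h4⟩
    refine ⟨h1, fun v hv hvZ => h2 hvZ ⟨v, hv, rfl⟩, h3, fun v e hv he => ?_, ?_⟩
    · exact h4 _ hv _ (by simp) (cellGraph_adj_inl_inr.2 he)
    · rintro v ⟨hv, e, he, hve⟩
      by_contra hvU
      exact hv (h4 _ he _ (by simpa using hvU) (cellGraph_adj_inl_inr.2 hve).symm)
  · rintro ⟨h1, h2, h3, h4, h5⟩
    refine ⟨h1, ?_, h3, ?_⟩
    · rintro _ hc ⟨v, hv, rfl⟩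
      exact h2 v hv hc
    · rintro (v | e) ha (w | f) hb hab
      · exact absurd hab not_cellGraph_adj_inl_inl
      · exact h4 v f ha (cellGraph_adj_inl_inr.1 hab)
      · by_contra hw
        exact hb ⟨w, h5 ⟨hw, e, ha, cellGraph_adj_inl_inr.1 hab.symm⟩, rfl⟩
      · exact absurd hab not_cellGraph_adj_inr_inr

theorem exists_component_mem (T : SignedTree V) (U : Set V) (e : T.graph.edgeSet) :
    ∃ Z, T.IsComponentOfCompl U Z ∧ Sum.inr e ∈ Z :=
  ⟨_, ⟨SimpleGraph.connectedComponentMk _ ⟨Sum.inr e, by simp⟩, rfl⟩,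
    ⟨Sum.inr e, by simp⟩, rfl, rfl⟩

namespace IsOpenSubtree

theorem nonempty {Z : Set T.Cell} (h : T.IsOpenSubtree Z) : Z.Nonempty := by
  obtain ⟨U, hU⟩ := h
  exact (isComponentOfCompl_iff.1 hU).1

theorem preconnected {Z : Set T.Cell} (h : T.IsOpenSubtree Z) :
    (T.cellGraph.induce Z).Preconnected := by
  obtain ⟨U, hU⟩ := h
  exact (isComponentOfCompl_iff.1 hU).2.2.1

theorem isOpenCells {Z : Set T.Cell} (h : T.IsOpenSubtree Z) : T.IsOpenCells Z := by
  obtain ⟨U, hU⟩ := h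
  exact (isComponentOfCompl_iff.1 hU).2.2.2.1

end IsOpenSubtree

/-- The Helly property of three pairwise intersecting connected sets of cells. -/
theorem inter_inter_nonempty {X Y Z : Set T.Cell}
    (hX : (T.cellGraph.induce X).Preconnected) (hY : (T.cellGraph.induce Y).Preconnected)
    (hZ : (T.cellGraph.induce Z).Preconnected) (oX : T.IsOpenCells X) (oY : T.IsOpenCells Y)
    (oZ : T.IsOpenCells Z) (hXY : (X ∩ Y).Nonempty) (hXZ : (X ∩ Z).Nonempty)
    (hYZ : (Y ∩ Z).Nonempty) : (X ∩ Y ∩ Z).Nonempty := by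
  by_contra hne
  rw [Set.not_nonempty_iff_eq_empty] at hne
  obtain ⟨c, hcX, hcY⟩ := hXY
  have hu : (T.cellGraph.induce (X ∪ Y)).Connected :=
    SimpleGraph.induce_union_connected hX hY ⟨c, hcX, hcY⟩
  have hs := T.cellGraph_isAcyclic.induce_inter_preconnected hu.preconnected hZ
  obtain ⟨a, haX, haZ⟩ := hXZ
  obtain ⟨b, hbY, hbZ⟩ := hYZ
  -- Leaving X ∩ Z within this connected set would happen at a vertex of Y, whose edges are in Y;
  -- the edge just used would then lie in all three sets.
  have hsub : (X ∪ Y) ∩ Z ⊆ X ∩ Z := by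
    refine subset_of_forall_boundary hs (oX.inter oZ) ⟨a, ⟨Or.inl haX, haZ⟩, haX, haZ⟩ ?_
    rintro v ⟨hv, e, he, hve⟩ ⟨hvXY, hvZ⟩
    have hvY : Sum.inl v ∈ Y := hvXY.resolve_left fun hvX => hv ⟨hvX, hvZ⟩
    exact hne.subset ⟨⟨he.1, oY v e hvY hve⟩, he.2⟩
  exact hne.subset ⟨⟨(hsub ⟨Or.inr hbY, hbZ⟩).1, hbY⟩, hbZ⟩

end SignedTree

/-! ### Tubes at a level, and compatibility -/

namespace SignedTree

variable {V : Type*} {T : SignedTree V}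

namespace SignedTube

/-- The vertices that a tube at level `A` requires to lie in `A`: the positive boundary and the
negative vertices in the intersection of the two parts. -/
def upper (W : T.SignedTube) : Set V :=
  T.boundary W.pos ∪ (T.negVerts ∩ T.verts (W.neg ∩ W.pos))

/-- The vertices that a tube at level `A` requires to lie outside `A`: the negative boundary and
the positive vertices in the intersection of the two parts. -/
def lower (W : T.SignedTube) : Set V :=
  T.boundary W.neg ∪ (T.posVerts ∩ T.verts (W.neg ∩ W.pos))

/-- The set `A` contains the upper vertices of the tube `W` and none of the lower ones. -/
def IsAtLevel (W : T.SignedTube) (A : Set V) : Prop :=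
  W.upper ⊆ A ∧ Disjoint W.lower A

theorem upper_subset_block (W : T.SignedTube) : W.upper ⊆ W.block := by
  rintro v (hv | ⟨hv, hvW, -⟩)
  · exact Or.inr ⟨(W.boundary_pos hv).1, hv.1⟩
  · exact Or.inl ⟨hv, hvW⟩

theorem disjoint_lower_block (W : T.SignedTube) : Disjoint W.lower W.block := by
  rw [Set.disjoint_left]
  rintro v (hv | ⟨hv, hvW⟩) (⟨h, hW⟩ | ⟨h, hW⟩)
  · exact hv.1 hW
  · exact h (W.boundary_neg hv).1
  · exact hv h
  · exact hW hvW.2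

theorem inter_nonempty (W : T.SignedTube) : (W.neg ∩ W.pos).Nonempty := by
  rcases (T.boundary W.neg).eq_empty_or_nonempty with h | ⟨v, hv⟩
  · rw [eq_univ_of_boundary_eq_empty W.neg_isOpenSubtree.isOpenCells W.neg_isOpenSubtree.nonempty h,
      Set.univ_inter]
    exact W.pos_isOpenSubtree.nonempty
  · obtain ⟨-, e, he, hve⟩ := id hv
    exact ⟨_, he, W.pos_isOpenSubtree.isOpenCells v e (W.boundary_neg hv).2 hve⟩

/-- The boundary of each part lies in the other part, so the union is open without boundary. -/
theorem neg_union_pos (W : T.SignedTube) : W.neg ∪ W.pos = Set.univ := by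
  refine eq_univ_of_boundary_eq_empty ?_ (W.neg_isOpenSubtree.nonempty.inl) ?_
  · rintro v e (h | h) he
    · exact Or.inl (W.neg_isOpenSubtree.isOpenCells v e h he)
    · exact Or.inr (W.pos_isOpenSubtree.isOpenCells v e h he)
  · rw [Set.eq_empty_iff_forall_notMem]
    rintro v ⟨hv, e, he | he, hve⟩
    · exact hv (Or.inr (W.boundary_neg ⟨fun h => hv (Or.inl h), e, he, hve⟩).2)
    · exact hv (Or.inl (W.boundary_pos ⟨fun h => hv (Or.inr h), e, he, hve⟩).2)

theorem mem_neg_or_mem_pos (W : T.SignedTube) (c : T.Cell) : c ∈ W.neg ∨ c ∈ W.pos :=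
  W.neg_union_pos.superset (Set.mem_univ c)

theorem inter_preconnected (W : T.SignedTube) :
    (T.cellGraph.induce (W.neg ∩ W.pos)).Preconnected :=
  T.cellGraph_isAcyclic.induce_inter_preconnected W.neg_isOpenSubtree.preconnected
    W.pos_isOpenSubtree.preconnected

theorem isOpenCells_inter (W : T.SignedTube) : T.IsOpenCells (W.neg ∩ W.pos) :=
  W.neg_isOpenSubtree.isOpenCells.inter W.pos_isOpenSubtree.isOpenCells

/-- Tubes at nested levels whose central parts meet are nested. -/
theorem negNested_of_isAtLevel {E F : T.SignedTube} {A A' : Set V} (hA : A' ⊆ A)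
    (hE : E.IsAtLevel A) (hF : F.IsAtLevel A') (h : (E.neg ∩ E.pos ∩ (F.neg ∩ F.pos)).Nonempty) :
    F.NegNested E := by
  obtain ⟨c, ⟨hcE, hcE'⟩, hcF, hcF'⟩ := h
  constructor
  · refine subset_of_forall_boundary F.neg_isOpenSubtree.preconnected
      E.neg_isOpenSubtree.isOpenCells ⟨c, hcF, hcE⟩ fun p hp hpF => ?_
    have hpA : p ∉ A := fun h => Set.disjoint_left.1 hE.2 (Or.inl hp) h
    have hpn := (E.boundary_neg hp).1
    have hpF' : Sum.inl p ∉ F.pos := fun h => hpA (hA (hF.1 (Or.inr ⟨hpn, hpF, h⟩)))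
    -- This puts an edge at p into F⁺, so p is a boundary vertex of F⁺ and hence positive, although
    -- it is negative as a boundary vertex of E⁻.
    have hsub : E.neg ∩ E.pos ⊆ F.pos := by
      refine subset_of_forall_boundary E.inter_preconnected F.pos_isOpenSubtree.isOpenCells
        ⟨c, ⟨hcE, hcE'⟩, hcF'⟩ fun q hq hqE => ?_
      exact Set.disjoint_left.1 hE.2 (Or.inr ⟨(F.boundary_pos hq).1, hqE⟩)
        (hA (hF.1 (Or.inl hq)))
    obtain ⟨-, e, he, hpe⟩ := id hp
    have he' := E.pos_isOpenSubtree.isOpenCells p e (E.boundary_neg hp).2 hpe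
    exact (F.boundary_pos ⟨hpF', e, hsub ⟨he, he'⟩, hpe⟩).1 hpn
  · refine subset_of_forall_boundary E.pos_isOpenSubtree.preconnected
      F.pos_isOpenSubtree.isOpenCells ⟨c, hcE', hcF'⟩ fun q hq hqE => ?_
    have hqA : q ∈ A := hA (hF.1 (Or.inl hq))
    have hqp := (F.boundary_pos hq).1
    have hqE' : Sum.inl q ∉ E.neg := fun h =>
      Set.disjoint_left.1 hE.2 (Or.inr ⟨hqp, h, hqE⟩) hqA
    have hsub : F.neg ∩ F.pos ⊆ E.neg := by
      refine subset_of_forall_boundary F.inter_preconnected E.neg_isOpenSubtree.isOpenCells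
        ⟨c, ⟨hcF, hcF'⟩, hcE⟩ fun p hp hpF => ?_
      exact Set.disjoint_left.1 hE.2 (Or.inl hp)
        (hA (hF.1 (Or.inr ⟨(E.boundary_neg hp).1, hpF⟩)))
    obtain ⟨-, e, he, hqe⟩ := id hq
    have he' := F.neg_isOpenSubtree.isOpenCells q e (F.boundary_pos hq).2 hqe
    exact hqp (E.boundary_neg ⟨hqE', e, hsub ⟨he', he⟩, hqe⟩).1

theorem Compatible.symm {E F : T.SignedTube} (h : E.Compatible F) : F.Compatible E := by
  rcases h with (h | h) | (h | h)
  · exact Or.inl (Or.inr h)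
  · exact Or.inl (Or.inl h)
  · exact Or.inr (Or.inl ⟨Set.inter_comm E.neg F.neg ▸ h.1, Set.union_comm E.pos F.pos ▸ h.2⟩)
  · exact Or.inr (Or.inr ⟨Set.union_comm E.neg F.neg ▸ h.1, Set.inter_comm E.pos F.pos ▸ h.2⟩)

/-- Tubes whose central parts are disjoint are compatible. -/
theorem compatible_of_inter_eq_empty {E F : T.SignedTube}
    (h : E.neg ∩ E.pos ∩ (F.neg ∩ F.pos) = ∅) : E.Compatible F := by
  -- If all four intersections of a part of E with a part of F are nonempty, the Helly property
  -- makes the central parts meet. If one is empty, then, as the parts of each tube cover T, it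
  -- gives one of the four compatibility conditions.
  by_cases h₁ : (E.neg ∩ F.neg).Nonempty
  · by_cases h₂ : (E.pos ∩ F.pos).Nonempty
    · by_cases h₃ : (E.neg ∩ F.pos).Nonempty
      · by_cases h₄ : (E.pos ∩ F.neg).Nonempty
        · exfalso
          have a₁ := inter_inter_nonempty E.neg_isOpenSubtree.preconnected
            E.pos_isOpenSubtree.preconnected F.neg_isOpenSubtree.preconnected
            E.neg_isOpenSubtree.isOpenCells E.pos_isOpenSubtree.isOpenCells
            F.neg_isOpenSubtree.isOpenCells E.inter_nonempty h₁ h₄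
          have a₂ := inter_inter_nonempty E.neg_isOpenSubtree.preconnected
            E.pos_isOpenSubtree.preconnected F.pos_isOpenSubtree.preconnected
            E.neg_isOpenSubtree.isOpenCells E.pos_isOpenSubtree.isOpenCells
            F.pos_isOpenSubtree.isOpenCells E.inter_nonempty h₃ h₂
          have a₃ := inter_inter_nonempty E.inter_preconnected F.neg_isOpenSubtree.preconnected
            F.pos_isOpenSubtree.preconnected E.isOpenCells_inter
            F.neg_isOpenSubtree.isOpenCells F.pos_isOpenSubtree.isOpenCells a₁ a₂ F.inter_nonempty
          rw [Set.inter_assoc, h] at a₃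
          exact Set.not_nonempty_empty a₃
        · refine Or.inl (Or.inr ⟨fun c hc => ?_, fun c hc => ?_⟩)
          · exact (E.mem_neg_or_mem_pos c).resolve_right fun hc' => h₄ ⟨c, hc', hc⟩
          · exact (F.mem_neg_or_mem_pos c).resolve_left fun hc' => h₄ ⟨c, hc, hc'⟩
      · refine Or.inl (Or.inl ⟨fun c hc => ?_, fun c hc => ?_⟩)
        · exact (F.mem_neg_or_mem_pos c).resolve_right fun hc' => h₃ ⟨c, hc, hc'⟩
        · exact (E.mem_neg_or_mem_pos c).resolve_left fun hc' => h₃ ⟨c, hc', hc⟩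
    · refine Or.inr (Or.inr ⟨Set.eq_univ_of_forall fun c => ?_, Set.not_nonempty_iff_eq_empty.1 h₂⟩)
      by_contra hc
      simp only [Set.mem_union, not_or] at hc
      exact h₂ ⟨c, (E.mem_neg_or_mem_pos c).resolve_left hc.1,
        (F.mem_neg_or_mem_pos c).resolve_left hc.2⟩
  · refine Or.inr (Or.inl ⟨Set.not_nonempty_iff_eq_empty.1 h₁, Set.eq_univ_of_forall fun c => ?_⟩)
    by_contra hc
    simp only [Set.mem_union, not_or] at hc
    exact h₁ ⟨c, (E.mem_neg_or_mem_pos c).resolve_right hc.1,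
      (F.mem_neg_or_mem_pos c).resolve_right hc.2⟩

theorem compatible_of_isAtLevel {E F : T.SignedTube} {A A' : Set V} (hA : A' ⊆ A)
    (hE : E.IsAtLevel A) (hF : F.IsAtLevel A') : E.Compatible F := by
  rcases (E.neg ∩ E.pos ∩ (F.neg ∩ F.pos)).eq_empty_or_nonempty with h | h
  · exact compatible_of_inter_eq_empty h
  · exact Or.inl (Or.inr (negNested_of_isAtLevel hA hE hF h))

theorem eq_of_isAtLevel {E F : T.SignedTube} {A : Set V} (hE : E.IsAtLevel A) (hF : F.IsAtLevel A)
    (h : (E.neg ∩ E.pos ∩ (F.neg ∩ F.pos)).Nonempty) : E = F := by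
  have h₁ := negNested_of_isAtLevel subset_rfl hE hF h
  have h₂ := negNested_of_isAtLevel subset_rfl hF hE (by rwa [Set.inter_comm])
  exact SignedTube.ext (h₂.1.antisymm h₁.1) (h₁.2.antisymm h₂.2)

/-- Every open edge lies in the central part of a tube at a given level. -/
theorem exists_isAtLevel (A : Set V) (e : T.graph.edgeSet) :
    ∃ W : T.SignedTube, W.IsAtLevel A ∧ Sum.inr e ∈ W.neg ∩ W.pos := by
  -- Z is the future central part. The parts M and P are found by cutting only at its negative,
  -- respectively positive, boundary vertices.
  obtain ⟨Z, hZ, heZ⟩ := T.exists_component_mem (symmDiff T.negVerts A) e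
  obtain ⟨M, hM, heM⟩ := T.exists_component_mem (T.boundary Z ∩ T.negVerts) e
  obtain ⟨P, hP, heP⟩ := T.exists_component_mem (T.boundary Z ∩ T.posVerts) e
  have hM' : T.IsOpenSubtree M := ⟨_, hM⟩
  have hP' : T.IsOpenSubtree P := ⟨_, hP⟩
  rw [isComponentOfCompl_iff] at hZ hM hP
  obtain ⟨-, hZU, hZc, hZo, hZb⟩ := hZ
  obtain ⟨-, hMU, hMc, hMo, hMb⟩ := hM
  obtain ⟨-, hPU, hPc, hPo, hPb⟩ := hP
  have hZM : Z ⊆ M := subset_of_forall_boundary hZc hMo ⟨_, heZ, heM⟩ fun v hv => (hMb hv).1.1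
  have hZP : Z ⊆ P := subset_of_forall_boundary hZc hPo ⟨_, heZ, heP⟩ fun v hv => (hPb hv).1.1
  have hMPZ : M ∩ P ⊆ Z := by
    refine subset_of_forall_boundary (T.cellGraph_isAcyclic.induce_inter_preconnected hMc hPc) hZo
      ⟨_, ⟨heM, heP⟩, heZ⟩ fun v hv hvMP => ?_
    by_cases hn : v ∈ T.negVerts
    · exact hMU v ⟨hv, hn⟩ hvMP.1
    · exact hPU v ⟨hv, hn⟩ hvMP.2
  have hbM : T.boundary M ⊆ T.negVerts ∩ T.verts P := by
    intro v hv
    have hvZ := hMb hv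
    refine ⟨hvZ.2, ?_⟩
    by_contra hvP
    obtain ⟨-, f, hf, hvf⟩ := hvZ.1
    exact (hPb ⟨hvP, f, hZP hf, hvf⟩).2 hvZ.2
  have hbP : T.boundary P ⊆ T.posVerts ∩ T.verts M := by
    intro v hv
    have hvZ := hPb hv
    refine ⟨hvZ.2, ?_⟩
    by_contra hvM
    obtain ⟨-, f, hf, hvf⟩ := hvZ.1
    exact hvZ.2 (hMb ⟨hvM, f, hZM hf, hvf⟩).2
  refine ⟨⟨M, P, hM', hP', hbM, hbP⟩, ⟨?_, ?_⟩, heM, heP⟩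
  · rintro v (hv | ⟨hvn, hv⟩)
    · rcases hZb (hPb hv).1 with h | h
      · exact absurd h.1 (hbP hv).1
      · exact h.1
    · by_contra hvA
      exact hZU v (Or.inl ⟨hvn, hvA⟩) (hMPZ hv)
  · rw [Set.disjoint_left]
    rintro v (hv | ⟨hvp, hv⟩) hvA
    · rcases hZb (hMb hv).1 with h | h
      · exact h.2 hvA
      · exact h.2 (hbM hv).1
    · exact hZU v (Or.inr ⟨hvA, hvp⟩) (hMPZ hv)

/-- Both ends of an edge in the central part of a tube are upper or lower vertices. -/
theorem mem_upper_or_mem_lower (W : T.SignedTube) {e : T.graph.edgeSet}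
    (he : Sum.inr e ∈ W.neg ∩ W.pos) {v : V} (hv : v ∈ (e : Sym2 V)) :
    v ∈ W.upper ∨ v ∈ W.lower := by
  by_cases h₁ : Sum.inl v ∈ W.neg
  · by_cases h₂ : Sum.inl v ∈ W.pos
    · by_cases hn : v ∈ T.negVerts
      · exact Or.inl (Or.inr ⟨hn, h₁, h₂⟩)
      · exact Or.inr (Or.inr ⟨hn, h₁, h₂⟩)
    · exact Or.inl (Or.inl ⟨h₂, e, he.2, hv⟩)
  · exact Or.inr (Or.inl ⟨h₁, e, he.1, hv⟩)

/-- The block of a tube does not separate the ends of an edge outside the central part. -/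
theorem mem_block_iff_of_notMem (W : T.SignedTube) {e : T.graph.edgeSet}
    (he : Sum.inr e ∉ W.neg ∩ W.pos) {v w : V} (hv : v ∈ (e : Sym2 V)) (hw : w ∈ (e : Sym2 V)) :
    v ∈ W.block ↔ w ∈ W.block := by
  -- Such an edge lies in exactly one part: its ends are both in the block if that part is W⁻, and
  -- both outside if it is W⁺.
  suffices h : ∀ v ∈ (e : Sym2 V), v ∈ W.block ↔ Sum.inr e ∉ W.pos by rw [h v hv, h w hw]
  intro v hv
  by_cases heP : Sum.inr e ∈ W.pos
  · have heN : Sum.inr e ∉ W.neg := fun h => he ⟨h, heP⟩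
    have hvN : Sum.inl v ∉ W.neg := fun h => heN (W.neg_isOpenSubtree.isOpenCells v e h hv)
    have hvP := (W.mem_neg_or_mem_pos (Sum.inl v)).resolve_left hvN
    simp only [heP, not_true_eq_false, iff_false]
    rintro (h | h)
    · exact hvN h.2
    · exact h.2 hvP
  · have heN := (W.mem_neg_or_mem_pos (Sum.inr e)).resolve_right heP
    have hvP : Sum.inl v ∉ W.pos := fun h => heP (W.pos_isOpenSubtree.isOpenCells v e h hv)
    have hvN := (W.mem_neg_or_mem_pos (Sum.inl v)).resolve_right hvP
    simp only [heP, not_false_eq_true, iff_true]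
    by_cases hn : v ∈ T.negVerts
    · exact Or.inl ⟨hn, hvN⟩
    · exact Or.inr ⟨hn, hvP⟩

theorem boundary_univ : T.boundary Set.univ = ∅ := by
  ext v
  simp [boundary, verts]

/-- Without upper vertices, W⁺ has no boundary, so it is T, and W⁻ has no negative vertex. With the
next two lemmas, relevance means that upper and lower vertices both exist, so that the set of
thresholds is bounded. -/
theorem upper_nonempty {W : T.SignedTube} (h : ¬ W.Irrelevant) : W.upper.Nonempty := by
  by_contra hne
  rw [Set.not_nonempty_iff_eq_empty, upper, Set.union_empty_iff] at hne
  have hP := eq_univ_of_boundary_eq_empty W.pos_isOpenSubtree.isOpenCells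
    W.pos_isOpenSubtree.nonempty hne.1
  refine h (Or.inl ⟨isComponentOfCompl_iff.2 ⟨W.neg_isOpenSubtree.nonempty, fun v hv hvW => ?_,
    W.neg_isOpenSubtree.preconnected, W.neg_isOpenSubtree.isOpenCells,
    fun v hv => (W.boundary_neg hv).1⟩, hP⟩)
  exact hne.2.subset ⟨hv, hvW, by simp [hP]⟩

theorem lower_nonempty {W : T.SignedTube} (h : ¬ W.Irrelevant) : W.lower.Nonempty := by
  by_contra hne
  rw [Set.not_nonempty_iff_eq_empty, lower, Set.union_empty_iff] at hne
  have hM := eq_univ_of_boundary_eq_empty W.neg_isOpenSubtree.isOpenCells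
    W.neg_isOpenSubtree.nonempty hne.1
  refine h (Or.inr ⟨hM, isComponentOfCompl_iff.2 ⟨W.pos_isOpenSubtree.nonempty, fun v hv hvW => ?_,
    W.pos_isOpenSubtree.preconnected, W.pos_isOpenSubtree.isOpenCells,
    fun v hv => (W.boundary_pos hv).1⟩⟩)
  exact hne.2.subset ⟨hv, by simp [hM], hvW⟩

theorem not_irrelevant {W : T.SignedTube} (h₁ : W.upper.Nonempty) (h₂ : W.lower.Nonempty) :
    ¬ W.Irrelevant := by
  rintro (⟨h, hP⟩ | ⟨hM, h⟩)
  · obtain ⟨v, hv | hv⟩ := h₁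
    · simp [hP, boundary_univ] at hv
    · exact (isComponentOfCompl_iff.1 h).2.1 v hv.1 hv.2.1
  · obtain ⟨v, hv | hv⟩ := h₂
    · simp [hM, boundary_univ] at hv
    · exact (isComponentOfCompl_iff.1 h).2.1 v hv.1 hv.2.2

/-- The block of a compatible tube that contains a lower vertex contains all upper vertices. -/
theorem Compatible.mem_block {E F : T.SignedTube} (h : E.Compatible F) {u l : V}
    (hu : u ∈ E.upper) (hl : l ∈ E.lower) (hlF : l ∈ F.block) : u ∈ F.block := by
  have huE := E.upper_subset_block hu
  have hlE := Set.disjoint_left.1 E.disjoint_lower_block hl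
  -- When nested, the blocks are nested too, and F.block ⊆ E.block is excluded by l. Negative
  -- disjointness keeps l out of F.block; positive disjointness forces u into it.
  rcases h with (h | h) | (h | h)
  · rcases huE with hu | hu
    · exact Or.inl ⟨hu.1, h.1 hu.2⟩
    · exact Or.inr ⟨hu.1, fun hF => hu.2 (h.2 hF)⟩
  · exfalso
    rcases hlF with hl' | hl'
    · exact hlE (Or.inl ⟨hl'.1, h.1 hl'.2⟩)
    · exact hlE (Or.inr ⟨hl'.1, fun hF => hl'.2 (h.2 hF)⟩)
  · exfalso
    rcases hl with hl | hl
    · obtain ⟨-, e, he, hle⟩ := id hl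
      rcases hlF with hl' | hl'
      · exact h.1.subset ⟨he, F.neg_isOpenSubtree.isOpenCells l e hl'.2 hle⟩
      · exact hl'.1 (E.boundary_neg hl).1
    · rcases hlF with hl' | hl'
      · exact hl.1 hl'.1
      · rcases F.mem_neg_or_mem_pos (Sum.inl l) with hl'' | hl''
        · exact h.1.subset ⟨hl.2.1, hl''⟩
        · exact hl'.2 hl''
  · rcases hu with hu | hu
    · obtain ⟨-, e, he, hue⟩ := id hu
      exact Or.inr ⟨(E.boundary_pos hu).1, fun huF =>
        h.2.subset ⟨he, F.pos_isOpenSubtree.isOpenCells u e huF hue⟩⟩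
    · refine Or.inl ⟨hu.1, (F.mem_neg_or_mem_pos (Sum.inl u)).resolve_right fun huF => ?_⟩
      exact h.2.subset ⟨hu.2.2, huF⟩

end SignedTube

end SignedTree

/-! ### Weights and the unique decomposition -/

namespace SignedTree

variable {V : Type*} {T : SignedTree V}

namespace SignedTube

open MeasureTheory

theorem ray_sub_ray [Fintype V] (W : T.SignedTube) (u v : V) :
    W.ray u - W.ray v = W.block.indicator 1 u - W.block.indicator (1 : V → ℝ) v := by
  simp [ray]

theorem ray_mem [Fintype V] (W : T.SignedTube) : W.ray ∈ sumZeroHyperplane V := by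
  classical
  have := T.isTree.1.nonempty
  change ∑ v, W.ray v = 0
  have h : ∑ v, W.block.indicator (1 : V → ℝ) v = W.block.ncard := by
    rw [Set.ncard_eq_toFinset_card', Finset.card_eq_sum_ones, Nat.cast_sum]
    simp [Set.indicator_apply]
  have h0 : (Fintype.card V : ℝ) ≠ 0 := Nat.cast_ne_zero.2 Fintype.card_ne_zero
  simp only [ray, Finset.sum_sub_distrib, h, Finset.sum_const, Finset.card_univ, nsmul_eq_mul]
  field_simp
  ring

/-- The set of thresholds at which the superlevel set of `x` has level `W`. -/
def levels (W : T.SignedTube) (x : V → ℝ) : Set ℝ := {t | W.IsAtLevel {v | t ≤ x v}}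

theorem mem_levels {W : T.SignedTube} {x : V → ℝ} {t : ℝ} :
    t ∈ W.levels x ↔ (∀ u ∈ W.upper, t ≤ x u) ∧ ∀ l ∈ W.lower, x l < t := by
  simp [levels, IsAtLevel, Set.disjoint_left, Set.subset_def]

/-- The ends are the maximum of x on the lower vertices and its minimum on the upper ones; the
interval is empty if these are in the wrong order. -/
theorem levels_eq_Ioc [Finite V] {W : T.SignedTube} (hW : ¬ W.Irrelevant) (x : V → ℝ) :
    ∃ u ∈ W.upper, ∃ l ∈ W.lower, W.levels x = Set.Ioc (x l) (x u) := by
  obtain ⟨u, hu, hu'⟩ := Set.exists_min_image W.upper x (Set.toFinite _) (upper_nonempty hW)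
  obtain ⟨l, hl, hl'⟩ := Set.exists_max_image W.lower x (Set.toFinite _) (lower_nonempty hW)
  refine ⟨u, hu, l, hl, ?_⟩
  ext t
  rw [mem_levels, Set.mem_Ioc]
  exact ⟨fun h => ⟨h.2 l hl, h.1 u hu⟩, fun h => ⟨fun a ha => h.2.trans (hu' a ha),
    fun a ha => (hl' a ha).trans_lt h.1⟩⟩

/-- The coefficient of the ray of `W` in the decomposition of `x` along the fan. -/
noncomputable def weight (x : V → ℝ) (W : T.RelevantTube) : ℝ := volume.real (W.1.levels x)

theorem weight_nonneg (x : V → ℝ) (W : T.RelevantTube) : 0 ≤ weight x W := measureReal_nonneg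

theorem levels_nonempty {x : V → ℝ} {W : T.RelevantTube} (h : weight x W ≠ 0) :
    (W.1.levels x).Nonempty := by
  by_contra hne
  rw [Set.not_nonempty_iff_eq_empty] at hne
  simp [weight, hne] at h

theorem compatible_of_weight_ne_zero {x : V → ℝ} {E F : T.RelevantTube} (hE : weight x E ≠ 0)
    (hF : weight x F ≠ 0) : E.1.Compatible F.1 := by
  obtain ⟨s, hs⟩ := levels_nonempty hE
  obtain ⟨t, ht⟩ := levels_nonempty hF
  rcases le_total s t with h | h
  · exact compatible_of_isAtLevel (fun v hv => h.trans hv) hs ht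
  · exact (compatible_of_isAtLevel (fun v hv => h.trans hv) ht hs).symm

theorem weight_eq_zero_of_le {x : V → ℝ} {W : T.RelevantTube} {u l : V} (hu : u ∈ W.1.upper)
    (hl : l ∈ W.1.lower) (h : x u ≤ x l) : weight x W = 0 := by
  by_contra hne
  obtain ⟨t, ht⟩ := levels_nonempty hne
  rw [mem_levels] at ht
  exact absurd ((ht.1 u hu).trans h) (ht.2 l hl).not_ge

/-- Only tubes with the edge in the central part can separate u from v, and those with v upper and u
lower have weight zero. -/
theorem weight_mul_sub_eq (x : V → ℝ) {u v : V} (h : T.graph.Adj u v) (hx : x v ≤ x u)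
    (W : T.RelevantTube) [Decidable (Sum.inr ⟨s(u, v), h⟩ ∈ W.1.neg ∩ W.1.pos ∧
      u ∈ W.1.upper ∧ v ∈ W.1.lower)] :
    weight x W * (W.1.block.indicator 1 u - W.1.block.indicator (1 : V → ℝ) v) =
      if Sum.inr ⟨s(u, v), h⟩ ∈ W.1.neg ∩ W.1.pos ∧ u ∈ W.1.upper ∧ v ∈ W.1.lower
        then weight x W else 0 := by
  have hup : ∀ w ∈ W.1.upper, W.1.block.indicator (1 : V → ℝ) w = 1 := fun w hw =>
    Set.indicator_of_mem (W.1.upper_subset_block hw) _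
  have hlo : ∀ w ∈ W.1.lower, W.1.block.indicator (1 : V → ℝ) w = 0 := fun w hw =>
    Set.indicator_of_notMem (Set.disjoint_left.1 W.1.disjoint_lower_block hw) _
  split_ifs with hS
  · rw [hup u hS.2.1, hlo v hS.2.2]
    ring
  · by_cases he : Sum.inr ⟨s(u, v), h⟩ ∈ W.1.neg ∩ W.1.pos
    · rcases W.1.mem_upper_or_mem_lower he (Sym2.mem_mk_left u v) with hu | hu <;>
        rcases W.1.mem_upper_or_mem_lower he (Sym2.mem_mk_right u v) with hv | hv
      · rw [hup u hu, hup v hv]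
        ring
      · exact absurd ⟨he, hu, hv⟩ hS
      · rw [weight_eq_zero_of_le hv hu hx, zero_mul]
      · rw [hlo u hu, hlo v hv]
        ring
    · have := W.1.mem_block_iff_of_notMem he (Sym2.mem_mk_left u v) (Sym2.mem_mk_right u v)
      by_cases hu : u ∈ W.1.block
      · simp [hu, this.1 hu]
      · simp [hu, mt this.2 hu]

theorem sum_weight_mul_sub_of_adj_of_le [Finite V] [Fintype T.RelevantTube] (x : V → ℝ) {u v : V}
    (h : T.graph.Adj u v) (hx : x v ≤ x u) :
    ∑ W : T.RelevantTube, weight x W *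
      (W.1.block.indicator 1 u - W.1.block.indicator (1 : V → ℝ) v) = x u - x v := by
  classical
  simp_rw [weight_mul_sub_eq x h hx]
  rw [← Finset.sum_filter]
  set S := Finset.univ.filter fun W : T.RelevantTube =>
    Sum.inr ⟨s(u, v), h⟩ ∈ W.1.neg ∩ W.1.pos ∧ u ∈ W.1.upper ∧ v ∈ W.1.lower with hS
  have hmem : ∀ W : T.RelevantTube, W ∈ S ↔
      Sum.inr ⟨s(u, v), h⟩ ∈ W.1.neg ∩ W.1.pos ∧ u ∈ W.1.upper ∧ v ∈ W.1.lower := by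
    simp [hS]
  have hU : ⋃ W ∈ S, W.1.levels x = Set.Ioc (x v) (x u) := by
    ext t
    simp only [Set.mem_iUnion, exists_prop]
    constructor
    · rintro ⟨W, hW, ht⟩
      rw [mem_levels] at ht
      exact ⟨ht.2 v ((hmem W).1 hW).2.2, ht.1 u ((hmem W).1 hW).2.1⟩
    · rintro ⟨ht₁, ht₂⟩
      obtain ⟨W, hW, he⟩ := exists_isAtLevel {w | t ≤ x w} ⟨s(u, v), h⟩
      have hu : u ∈ W.upper :=
        (W.mem_upper_or_mem_lower he (Sym2.mem_mk_left u v)).resolve_right fun hu =>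
          Set.disjoint_left.1 hW.2 hu ht₂
      have hv : v ∈ W.lower :=
        (W.mem_upper_or_mem_lower he (Sym2.mem_mk_right u v)).resolve_left fun hv =>
          ht₁.not_ge (hW.1 hv)
      exact ⟨⟨W, not_irrelevant ⟨u, hu⟩ ⟨v, hv⟩⟩, (hmem _).2 ⟨he, hu, hv⟩, hW⟩
  have hI : ∀ W : T.RelevantTube, ∃ a b, W.1.levels x = Set.Ioc a b := fun W => by
    obtain ⟨a, -, b, -, hab⟩ := levels_eq_Ioc W.2 x
    exact ⟨_, _, hab⟩
  -- A common threshold of two tubes of S would make them equal, since the edge uv lies in both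
  -- central parts.
  have hvol : volume.real (⋃ W ∈ S, W.1.levels x) = ∑ W ∈ S, weight x W := by
    refine measureReal_biUnion_finset ?_ ?_ ?_
    · intro E hE F hF hEF
      refine Set.disjoint_left.2 fun t htE htF => hEF (Subtype.ext (eq_of_isAtLevel htE htF ?_))
      exact ⟨_, ((hmem E).1 hE).1, ((hmem F).1 hF).1⟩
    · intro W _
      obtain ⟨a, b, hab⟩ := hI W
      rw [hab]
      exact measurableSet_Ioc
    · intro W _
      obtain ⟨a, b, hab⟩ := hI W
      rw [hab]
      simp
  rw [← hvol, hU, Real.volume_real_Ioc_of_le hx]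

theorem sum_weight_mul_sub [Finite V] [Fintype T.RelevantTube] (x : V → ℝ) (u v : V) :
    ∑ W : T.RelevantTube, weight x W *
      (W.1.block.indicator 1 u - W.1.block.indicator (1 : V → ℝ) v) = x u - x v := by
  obtain ⟨p⟩ := T.isTree.1.preconnected u v
  induction p with
  | nil => simp
  | @cons a b c hadj _ ih =>
    have hab : ∑ W : T.RelevantTube, weight x W *
        (W.1.block.indicator 1 a - W.1.block.indicator (1 : V → ℝ) b) = x a - x b := by
      rcases le_total (x b) (x a) with h | h
      · exact sum_weight_mul_sub_of_adj_of_le x hadj h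
      · rw [← neg_inj, neg_sub, ← sum_weight_mul_sub_of_adj_of_le x hadj.symm h,
          ← Finset.sum_neg_distrib]
        exact Finset.sum_congr rfl fun _ _ => by ring
    rw [← sub_add_sub_cancel (x a) (x b) (x c), ← hab, ← ih, ← Finset.sum_add_distrib]
    exact Finset.sum_congr rfl fun _ _ => by ring

theorem sum_smul_ray_sub [Fintype V] [Fintype T.RelevantTube] (c : T.RelevantTube → ℝ) (u v : V) :
    (∑ W, c W • W.1.ray) u - (∑ W, c W • W.1.ray) v =
      ∑ W, c W * (W.1.block.indicator 1 u - W.1.block.indicator (1 : V → ℝ) v) := by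
  simp only [Finset.sum_apply, Pi.smul_apply, smul_eq_mul, ← Finset.sum_sub_distrib, ← mul_sub,
    ray_sub_ray]

/-- Every vector with coordinate sum zero is decomposed by its weights. -/
theorem sum_weight_smul_ray [Fintype V] [Fintype T.RelevantTube] {x : V → ℝ}
    (hx : x ∈ sumZeroHyperplane V) : ∑ W : T.RelevantTube, weight x W • W.1.ray = x := by
  have := T.isTree.1.nonempty
  set y := ∑ W : T.RelevantTube, weight x W • W.1.ray with hy
  have hmem : y ∈ sumZeroHyperplane V :=
    Submodule.sum_mem _ fun W _ => Submodule.smul_mem _ _ W.1.ray_mem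
  have hd : ∀ u v, y u - y v = x u - x v := fun u v => by
    rw [hy, sum_smul_ray_sub, sum_weight_mul_sub]
  have hxs : ∑ v, x v = 0 := hx
  have hys : ∑ v, y v = 0 := hmem
  ext u
  have h : ∑ v, (y u - y v) = ∑ v, (x u - x v) := Finset.sum_congr rfl fun v _ => hd u v
  simp only [Finset.sum_sub_distrib, hxs, hys, Finset.sum_const, sub_zero, Finset.card_univ,
    nsmul_eq_mul] at h
  exact mul_left_cancel₀ (Nat.cast_ne_zero.2 Fintype.card_ne_zero) h

/-- The weight of E is at least x u - x l for an upper vertex u and a lower vertex l. In this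
difference E contributes c E, and by `Compatible.mem_block` no other tube contributes negatively. -/
theorem le_weight_sum [Fintype V] [Fintype T.RelevantTube]
    {c : T.RelevantTube → ℝ} (h0 : ∀ W, 0 ≤ c W)
    (hc : ∀ E F, c E ≠ 0 → c F ≠ 0 → E.1.Compatible F.1) (E : T.RelevantTube) :
    c E ≤ weight (∑ W, c W • W.1.ray) E := by
  rcases eq_or_ne (c E) 0 with hE | hE
  · rw [hE]
    exact weight_nonneg _ _
  obtain ⟨u, hu, l, hl, h⟩ := levels_eq_Ioc E.2 (∑ W, c W • W.1.ray)
  rw [weight, h, Real.volume_real_Ioc]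
  refine le_max_of_le_left ?_
  rw [sum_smul_ray_sub]
  have hterm : c E * (E.1.block.indicator 1 u - E.1.block.indicator (1 : V → ℝ) l) = c E := by
    rw [Set.indicator_of_mem (E.1.upper_subset_block hu),
      Set.indicator_of_notMem (Set.disjoint_left.1 E.1.disjoint_lower_block hl)]
    simp
  conv_lhs => rw [← hterm]
  refine Finset.single_le_sum
    (f := fun W => c W * (W.1.block.indicator 1 u - W.1.block.indicator (1 : V → ℝ) l))
    (fun F _ => ?_) (Finset.mem_univ E)
  rcases eq_or_ne (c F) 0 with hF | hF
  · simp [hF]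
  refine mul_nonneg (h0 F) (sub_nonneg.2 ?_)
  by_cases hlF : l ∈ F.1.block
  · rw [Set.indicator_of_mem ((hc E F hE hF).mem_block hu hl hlF), Set.indicator_of_mem hlF]
    simp
  · rw [Set.indicator_of_notMem hlF]
    exact Set.indicator_nonneg (fun _ _ => zero_le_one) _

/-- A nonnegative combination of rays of pairwise compatible tubes is the decomposition by
weights. -/
theorem eq_weight_sum [Fintype V] [Fintype T.RelevantTube]
    {c : T.RelevantTube → ℝ} (h0 : ∀ W, 0 ≤ c W)
    (hc : ∀ E F, c E ≠ 0 → c F ≠ 0 → E.1.Compatible F.1) :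
    c = weight (∑ W, c W • W.1.ray) := by
  set x := ∑ W, c W • W.1.ray with hx
  have hmem : x ∈ sumZeroHyperplane V :=
    Submodule.sum_mem _ fun W _ => Submodule.smul_mem _ _ W.1.ray_mem
  have hle : ∀ W, c W ≤ weight x W := le_weight_sum h0 hc
  have hsum : ∑ W, (weight x W - c W) • W.1.ray = 0 := by
    simp only [sub_smul, Finset.sum_sub_distrib, sum_weight_smul_ray hmem, ← hx, sub_self]
  -- The difference is supported in the support of `weight x`, so its tubes are compatible and
  -- `le_weight_sum` applies to it.
  have hne : ∀ W, weight x W - c W ≠ 0 → weight x W ≠ 0 := by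
    intro W hW h
    have := hle W
    rw [h] at this
    exact hW (by rw [h, le_antisymm this (h0 W), sub_zero])
  have hd := le_weight_sum (c := fun W => weight x W - c W) (fun W => sub_nonneg.2 (hle W))
    fun E F hE hF => compatible_of_weight_ne_zero (hne E hE) (hne F hF)
  ext W
  have hW := hd W
  rw [hsum] at hW
  obtain ⟨u, hu⟩ := upper_nonempty W.2
  obtain ⟨l, hl⟩ := lower_nonempty W.2
  rw [weight_eq_zero_of_le (x := 0) hu hl (le_refl (0 : ℝ))] at hW
  exact le_antisymm (hle W) (sub_nonpos.1 hW)

end SignedTube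

end SignedTree

/-! ### From unique conic coordinates to fans and spheres -/

namespace PointedCone

theorem mem_hull_image_iff {ι E : Type*} [Fintype ι] [AddCommGroup E] [Module ℝ E] {ρ : ι → E}
    {s : Set ι} {x : E} :
    x ∈ PointedCone.hull ℝ (ρ '' s) ↔
      ∃ c : ι → ℝ, (∀ i, 0 ≤ c i) ∧ (∀ i, i ∉ s → c i = 0) ∧ ∑ i, c i • ρ i = x := by
  classical
  constructor
  · intro hx
    induction hx using Submodule.span_induction with
    | mem x h =>
      obtain ⟨i, hi, rfl⟩ := h
      refine ⟨Pi.single i 1, fun j => ?_, fun j hj => ?_, ?_⟩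
      · by_cases h : j = i
        · subst h
          simp
        · simp [h]
      · exact Pi.single_eq_of_ne (by rintro rfl; exact hj hi) _
      · rw [Finset.sum_eq_single i (fun j _ hj => by simp [hj]) (by simp)]
        simp
    | zero => exact ⟨0, fun _ => le_rfl, fun _ _ => rfl, by simp⟩
    | add x y _ _ hx hy =>
      obtain ⟨c, hc, hcs, rfl⟩ := hx
      obtain ⟨d, hd, hds, rfl⟩ := hy
      exact ⟨c + d, fun i => add_nonneg (hc i) (hd i), fun i hi => by simp [hcs i hi, hds i hi],
        by simp [add_smul, Finset.sum_add_distrib]⟩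
    | smul a x _ hx =>
      obtain ⟨c, hc, hcs, rfl⟩ := hx
      refine ⟨fun i => a.1 * c i, fun i => mul_nonneg a.2 (hc i), fun i hi => by simp [hcs i hi], ?_⟩
      simp only [mul_smul, ← Finset.smul_sum]
      rfl
  · rintro ⟨c, hc, hcs, rfl⟩
    refine Submodule.sum_mem _ fun i _ => ?_
    by_cases hi : i ∈ s
    · exact PointedCone.smul_mem _ (hc i) (PointedCone.subset_hull ⟨i, hi, rfl⟩)
    · simp [hcs i hi]

end PointedCone

namespace AbstractSimplicialComplex

variable {ι E : Type*}

/-- Nonnegative coefficients that vanish outside a (possibly empty) face. -/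
def IsConeCoord (K : AbstractSimplicialComplex ι) (c : ι → ℝ) : Prop :=
  (∀ i, 0 ≤ c i) ∧ ∃ s ∈ insert ∅ K.faces, ∀ i, i ∉ s → c i = 0

theorem IsConeCoord.smul {K : AbstractSimplicialComplex ι} {c : ι → ℝ} (hc : K.IsConeCoord c)
    {a : ℝ} (ha : 0 ≤ a) : K.IsConeCoord (a • c) := by
  obtain ⟨h0, s, hs, h⟩ := hc
  exact ⟨fun i => mul_nonneg ha (h0 i), s, hs, fun i hi => by simp [h i hi]⟩

/-- A complex is realized by a complete fan as soon as each vector has exactly one expression as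
a nonnegative combination of the rays of a face. -/
theorem isRealizedByCompleteFan_of_existsUnique [Fintype ι] [AddCommGroup E] [Module ℝ E]
    {K : AbstractSimplicialComplex ι} {H : Submodule ℝ E} {ρ : ι → E} (hρ : ∀ i, ρ i ∈ H)
    (hex : ∀ x ∈ H, ∃ c, K.IsConeCoord c ∧ ∑ i, c i • ρ i = x)
    (huniq : ∀ c d, K.IsConeCoord c → K.IsConeCoord d → ∑ i, c i • ρ i = ∑ i, d i • ρ i → c = d) :
    K.IsRealizedByCompleteFan H ρ where
  linearIndependent s hs := by
    classical
    rw [linearIndepOn_finset_iff]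
    intro f hf i hi
    -- A linear relation on s, split into positive and negative parts, gives two conic expressions
    -- of one vector, which must agree.
    let c : ι → ℝ := fun i => if i ∈ s then max (f i) 0 else 0
    let d : ι → ℝ := fun i => if i ∈ s then max (-f i) 0 else 0
    have hcd : ∀ i, c i - d i = if i ∈ s then f i else 0 := by
      intro i
      by_cases hi : i ∈ s
      · simp only [c, d, hi, if_true]
        rcases le_total (f i) 0 with h | h
        · rw [max_eq_right h, max_eq_left (by linarith)]
          ring
        · rw [max_eq_left h, max_eq_right (by linarith)]
          ring
      · simp [c, d, hi]
    have hc : K.IsConeCoord c := by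
      refine ⟨fun i => ?_, s, Or.inr hs, fun i hi => by simp [c, hi]⟩
      simp only [c]
      split_ifs
      exacts [le_max_right _ _, le_rfl]
    have hd : K.IsConeCoord d := by
      refine ⟨fun i => ?_, s, Or.inr hs, fun i hi => by simp [d, hi]⟩
      simp only [d]
      split_ifs
      exacts [le_max_right _ _, le_rfl]
    have h := huniq c d hc hd (by
      rw [← sub_eq_zero, ← Finset.sum_sub_distrib]
      simpa [← sub_smul, hcd, ite_smul, Finset.sum_ite_mem] using hf)
    have := hcd i
    rw [h, sub_self, if_pos hi] at this
    exact this.symm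
  cone_inter s hs t ht := by
    ext x
    constructor
    · rintro ⟨hxs, hxt⟩
      obtain ⟨c, hc, hcs, rfl⟩ := PointedCone.mem_hull_image_iff.1 hxs
      obtain ⟨d, hd, hdt, h⟩ := PointedCone.mem_hull_image_iff.1 hxt
      obtain rfl := huniq d c ⟨hd, t, Or.inr ht, hdt⟩ ⟨hc, s, Or.inr hs, hcs⟩ h
      refine PointedCone.mem_hull_image_iff.2 ⟨d, hc, fun i hi => ?_, rfl⟩
      by_cases his : i ∈ s
      · exact hdt i fun hit => hi ⟨his, hit⟩
      · exact hcs i his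
    · intro hx
      exact ⟨Submodule.span_mono (Set.image_mono Set.inter_subset_left) hx,
        Submodule.span_mono (Set.image_mono Set.inter_subset_right) hx⟩
  complete := by
    ext x
    simp only [Set.mem_iUnion, exists_prop, SetLike.mem_coe]
    constructor
    · rintro ⟨s, -, hx⟩
      obtain ⟨c, -, -, rfl⟩ := PointedCone.mem_hull_image_iff.1 hx
      exact Submodule.sum_mem _ fun i _ => Submodule.smul_mem _ _ (hρ i)
    · intro hx
      obtain ⟨c, ⟨hc, s, hs, hcs⟩, rfl⟩ := hex x hx
      exact ⟨s, hs, PointedCone.mem_hull_image_iff.2 ⟨c, hc, hcs, rfl⟩⟩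

/-- The empty face allowed in `IsConeCoord` is ruled out by the coordinate sum 1. -/
theorem mem_realization_iff [Fintype ι] {K : AbstractSimplicialComplex ι} {x : ι → ℝ} :
    x ∈ K.realization ↔ K.IsConeCoord x ∧ ∑ i, x i = 1 := by
  have hsum : ∀ s : Finset ι, (∀ i, i ∉ s → x i = 0) → ∑ i ∈ s, x i = ∑ i, x i := fun s h =>
    Finset.sum_subset (Finset.subset_univ s) fun i _ hi => h i hi
  constructor
  · rintro ⟨s, hs, h0, h, h1⟩
    exact ⟨⟨h0, s, Or.inr hs, h⟩, hsum s h ▸ h1⟩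
  · rintro ⟨⟨h0, s, hs, h⟩, h1⟩
    rcases hs with rfl | hs
    · rw [← hsum ∅ h] at h1
      simp at h1
    · exact ⟨s, hs, h0, h, (hsum s h).trans h1⟩

theorem isCompact_realization [Finite ι] (K : AbstractSimplicialComplex ι) :
    IsCompact K.realization := by
  have := Fintype.ofFinite ι
  have hK : K.realization = ⋃ s ∈ K.faces,
      {x | (∀ i, 0 ≤ x i) ∧ (∀ i, i ∉ s → x i = 0) ∧ ∑ i ∈ s, x i = 1} := by
    ext x
    simp only [realization, Set.mem_iUnion, exists_prop]
    rfl
  rw [hK]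
  refine (Set.toFinite _).isCompact_biUnion fun s _ => ?_
  refine IsCompact.of_isClosed_subset (isCompact_Icc (a := (0 : ι → ℝ)) (b := 1)) ?_ ?_
  · simp only [Set.ofPred_and, Set.ofPred_forall]
    refine IsClosed.inter ?_ (IsClosed.inter ?_ ?_)
    · exact isClosed_iInter fun i => isClosed_le continuous_const (continuous_apply i)
    · exact isClosed_iInter fun i => isClosed_iInter fun _ =>
        isClosed_eq (continuous_apply i) continuous_const
    · exact isClosed_eq (continuous_finsetSum _ fun i _ => continuous_apply i) continuous_const
  · rintro x ⟨h0, h, h1⟩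
    refine ⟨h0, fun i => ?_⟩
    by_cases hi : i ∈ s
    · rw [Pi.one_apply, ← h1]
      exact Finset.single_le_sum (fun j _ => h0 j) hi
    · rw [h i hi]
      exact zero_le_one

/-- Radial projection: a complex is a simplicial sphere as soon as each vector of a space of
dimension `n` has exactly one expression as a nonnegative combination of the rays of a face. -/
theorem isSimplicialSphere_of_existsUnique [Fintype ι] {n : ℕ}
    {K : AbstractSimplicialComplex ι} {ρ : ι → EuclideanSpace ℝ (Fin n)}
    (hex : ∀ x, ∃ c, K.IsConeCoord c ∧ ∑ i, c i • ρ i = x)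
    (huniq : ∀ c d, K.IsConeCoord c → K.IsConeCoord d → ∑ i, c i • ρ i = ∑ i, d i • ρ i → c = d) :
    K.IsSimplicialSphere n := by
  let Φ : (ι → ℝ) → EuclideanSpace ℝ (Fin n) := fun c => ∑ i, c i • ρ i
  have hΦsmul : ∀ (a : ℝ) c, Φ (a • c) = a • Φ c := fun a c => by
    simp [Φ, mul_smul, Finset.smul_sum]
  have hΦc : Continuous Φ :=
    continuous_finsetSum _ fun i _ => (continuous_apply i).smul continuous_const
  have hzero : K.IsConeCoord 0 := ⟨fun _ => le_rfl, ∅, Or.inl rfl, fun _ _ => rfl⟩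
  have hΦ0 : ∀ x : K.realization, ‖Φ x‖ ≠ 0 := by
    intro x hx
    obtain ⟨hxc, hx1⟩ := mem_realization_iff.1 x.2
    have := huniq x 0 hxc hzero (by simpa [Φ] using norm_eq_zero.1 hx)
    simp [this] at hx1
  let f : K.realization → Metric.sphere (0 : EuclideanSpace ℝ (Fin n)) 1 := fun x =>
    ⟨‖Φ x‖⁻¹ • Φ x, by
      rw [mem_sphere_zero_iff_norm, norm_smul, norm_inv, norm_norm, inv_mul_cancel₀ (hΦ0 x)]⟩
  have hf : Continuous f := by
    have h := hΦc.comp (continuous_subtype_val (p := (· ∈ K.realization)))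
    exact ((h.norm.inv₀ hΦ0).smul h).subtype_mk _
  have hinj : Function.Injective f := by
    intro x y hxy
    obtain ⟨hxc, hx1⟩ := mem_realization_iff.1 x.2
    obtain ⟨hyc, hy1⟩ := mem_realization_iff.1 y.2
    have h : Φ (‖Φ x‖⁻¹ • x) = Φ (‖Φ y‖⁻¹ • y) := by
      rw [hΦsmul, hΦsmul]
      exact congrArg Subtype.val hxy
    have h' := huniq _ _ (hxc.smul (inv_nonneg.2 (norm_nonneg _)))
      (hyc.smul (inv_nonneg.2 (norm_nonneg _))) h
    -- Both x and y have coordinate sum 1, so the sums of the rescaled coordinates recover the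
    -- factors.
    have hs : ‖Φ x‖⁻¹ = ‖Φ y‖⁻¹ := by
      have := congrArg (fun c : ι → ℝ => ∑ i, c i) h'
      simpa [← Finset.mul_sum, hx1, hy1] using this
    rw [hs] at h'
    exact Subtype.ext (smul_right_injective _ (inv_ne_zero (hΦ0 y)) h')
  have hsurj : Function.Surjective f := by
    rintro ⟨y, hy⟩
    rw [mem_sphere_zero_iff_norm] at hy
    obtain ⟨c, hc, hcy⟩ := hex y
    have hpos : 0 < ∑ i, c i := by
      refine lt_of_le_of_ne (Finset.sum_nonneg fun i _ => hc.1 i) fun h => ?_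
      have h0 := (Finset.sum_eq_zero_iff_of_nonneg fun i _ => hc.1 i).1 h.symm
      have : y = 0 := by
        rw [← hcy]
        exact Finset.sum_eq_zero fun i hi => by rw [h0 i hi, zero_smul]
      simp [this] at hy
    refine ⟨⟨(∑ i, c i)⁻¹ • c, mem_realization_iff.2 ⟨hc.smul (inv_nonneg.2 hpos.le), ?_⟩⟩, ?_⟩
    · simp [← Finset.mul_sum, hpos.ne']
    · apply Subtype.ext
      change ‖Φ _‖⁻¹ • Φ _ = y
      have hy' : Φ c = y := hcy
      rw [hΦsmul, hy', norm_smul, hy, norm_inv, Real.norm_of_nonneg hpos.le, mul_one, inv_inv,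
        smul_smul, mul_inv_cancel₀ hpos.ne', one_smul]
  have := isCompact_iff_compactSpace.1 K.isCompact_realization
  exact ⟨Continuous.homeoOfEquivCompactToT2 (f := Equiv.ofBijective f ⟨hinj, hsurj⟩) hf⟩

end AbstractSimplicialComplex

/-! ### Dimension count and conclusion -/

theorem finrank_sumZeroHyperplane (V : Type*) [Fintype V] [Nonempty V] :
    Module.finrank ℝ (sumZeroHyperplane V) = Fintype.card V - 1 := by
  classical
  let φ : (V → ℝ) →ₗ[ℝ] ℝ := ∑ v, LinearMap.proj v
  have hφ : ∀ x, φ x = ∑ v, x v := fun x => by simp [φ]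
  have hker : sumZeroHyperplane V = LinearMap.ker φ := by
    ext x
    rw [LinearMap.mem_ker, hφ]
    rfl
  have hsurj : Function.Surjective φ := fun a =>
    ⟨Pi.single (Classical.arbitrary V) a, by rw [hφ, Finset.sum_pi_single']; simp⟩
  have h := φ.finrank_range_add_finrank_ker
  rw [LinearMap.range_eq_top.2 hsurj, finrank_top, Module.finrank_self,
    Module.finrank_fintype_fun_eq_card] at h
  rw [hker]
  omega

/-- The complex is a flag complex, so the support of c, if nonempty, is itself a face. -/
theorem SignedTree.isConeCoord_signedNestedComplex_iff {V : Type*} [Finite V] {T : SignedTree V}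
    {c : T.RelevantTube → ℝ} :
    T.signedNestedComplex.IsConeCoord c ↔
      (∀ W, 0 ≤ c W) ∧ ∀ E F, c E ≠ 0 → c F ≠ 0 → E.1.Compatible F.1 := by
  classical
  have := Fintype.ofFinite T.RelevantTube
  refine and_congr_right fun _ => ⟨?_, fun h => ?_⟩
  · rintro ⟨s, hs, h⟩ E F hE hF
    have hEs : E ∈ s := by_contra fun hn => hE (h E hn)
    have hFs : F ∈ s := by_contra fun hn => hF (h F hn)
    rcases hs with rfl | hs
    · simp at hEs
    · exact hs.2 E hEs F hFs
  · refine ⟨Finset.univ.filter (c · ≠ 0), ?_, fun W hW => by simpa using hW⟩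
    rcases (Finset.univ.filter (c · ≠ 0)).eq_empty_or_nonempty with h0 | h0
    · exact Or.inl h0
    · exact Or.inr ⟨h0, fun E hE F hF => h E F (by simpa using hE) (by simpa using hF)⟩

theorem corollary46 {V : Type*} [Fintype V] (T : SignedTree V) :
    T.signedNestedComplex.IsSimplicialSphere (Fintype.card V - 1) ∧
    T.signedNestedComplex.IsRealizedByCompleteFan (sumZeroHyperplane V) (fun W => W.1.ray) := by
  have := T.isTree.1.nonempty
  have := Fintype.ofFinite T.RelevantTube
  have hex : ∀ x ∈ sumZeroHyperplane V, ∃ c : T.RelevantTube → ℝ,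
      T.signedNestedComplex.IsConeCoord c ∧ ∑ W, c W • W.1.ray = x := fun x hx =>
    ⟨SignedTree.SignedTube.weight x, SignedTree.isConeCoord_signedNestedComplex_iff.2
      ⟨SignedTree.SignedTube.weight_nonneg x,
        fun _ _ => SignedTree.SignedTube.compatible_of_weight_ne_zero⟩,
      SignedTree.SignedTube.sum_weight_smul_ray hx⟩
  have huniq : ∀ c d : T.RelevantTube → ℝ, T.signedNestedComplex.IsConeCoord c →
      T.signedNestedComplex.IsConeCoord d → ∑ W, c W • W.1.ray = ∑ W, d W • W.1.ray → c = d := by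
    intro c d hc hd h
    rw [SignedTree.isConeCoord_signedNestedComplex_iff] at hc hd
    rw [SignedTree.SignedTube.eq_weight_sum hc.1 hc.2, h,
      ← SignedTree.SignedTube.eq_weight_sum hd.1 hd.2]
  refine ⟨?_, AbstractSimplicialComplex.isRealizedByCompleteFan_of_existsUnique
    (fun W => W.1.ray_mem) hex huniq⟩
  -- Any linear isomorphism will do: unique conic coordinates are a linear notion, and the radial
  -- projection takes place in the target.
  let L : sumZeroHyperplane V ≃ₗ[ℝ] EuclideanSpace ℝ (Fin (Fintype.card V - 1)) :=
    LinearEquiv.ofFinrankEq _ _ (by rw [finrank_sumZeroHyperplane, finrank_euclideanSpace_fin])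
  have hL : ∀ c : T.RelevantTube → ℝ, ∑ W, c W • L ⟨W.1.ray, W.1.ray_mem⟩ =
      L (∑ W, c W • ⟨W.1.ray, W.1.ray_mem⟩) := fun c => by
    simp only [map_sum, map_smul]
  have hval : ∀ c : T.RelevantTube → ℝ,
      ((∑ W, c W • (⟨W.1.ray, W.1.ray_mem⟩ : sumZeroHyperplane V) : sumZeroHyperplane V) :
        V → ℝ) = ∑ W, c W • W.1.ray := fun c => by simp
  refine AbstractSimplicialComplex.isSimplicialSphere_of_existsUnique
    (ρ := fun W => L ⟨W.1.ray, W.1.ray_mem⟩) (fun x => ?_) fun c d hc hd h => ?_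
  · obtain ⟨c, hc, hcx⟩ := hex (L.symm x) (L.symm x).2
    refine ⟨c, hc, ?_⟩
    rw [hL, ← L.eq_symm_apply]
    exact Subtype.ext ((hval c).trans hcx)
  · rw [hL, hL] at h
    refine huniq c d hc hd ?_
    rw [← hval c, ← hval d, L.injective h]
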